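/- Let $N,K\ge 1$ be integers and $0\le M\le N$ real. For an integer $F\ge 1$, let $W_0,\dots,W_{N-1}$ be files with values in $[2^F]=\{0,\dots,2^F-1\}$, write $\bar W=(W_0,\dots,W_{N-1})$, and let $\bar D=(D_0,\dots,D_{K-1})\in[N]^K$ be the demands of $K$ users. For real $r$, $[2^{rF}]$ denotes a set of $\lfloor 2^{rF}\rfloor$ messages. An $(N,K,M,R)$-non-private scheme with file size $F$ consists of maps $C_k:[2^F]^N\to[2^{MF}]$, $E:[2^F]^N\times[N]^K\to[2^{RF}]$ and $G_k:[N]^K\times[2^{RF}]\times[2^{MF}]\to[2^F]$ ($0\le k<K$) such that $W_{D_k}=G_k(\bar D,E(\bar W,\bar D),C_k(\bar W))$ for all $k,\bar D,\bar W$. Let $R^*_{N,K}(M)$ be the infimum of all $R\ge 0$ for which such a scheme exists for some $F\ge 1$. An $(N,K,M,R)$-private scheme with file size $F$ consists of shared randomness $S_0,\dots,S_{K-1}$ with values in finite sets $\mathcal S_k$ and private server randomness $P$ with values in a probability space $\mathcal P$, a finite set $\mathcal J$, and maps (measurable in the value of $P$) $C_k:\mathcal S_k\times\mathcal P\times[2^F]^N\to[2^{MF}]$,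 $E:[2^F]^N\times[N]^K\times\mathcal P\times\prod_k\mathcal S_k\to[2^{RF}]$, $J:[N]^K\times\mathcal P\times\prod_k\mathcal S_k\to\mathcal J$, $G_k:[N]\times\mathcal S_k\times\mathcal J\times[2^{RF}]\times[2^{MF}]\to[2^F]$ such that, with $\bar S=(S_0,\dots,S_{K-1})$, $X=(E(\bar W,\bar D,P,\bar S),J(\bar D,P,\bar S))$ and $Z_k=(C_k(S_k,P,\bar W),S_k)$: 1. (decoding) $W_{D_k}=G_k\bigl(D_k,S_k,J(\bar D,P,\bar S),E(\bar W,\bar D,P,\bar S),C_k(S_k,P,\bar W)\bigr)$ for all $k$ and all values of $\bar W,\bar D,P,\bar S$; 2. (privacy) when $P$, all $S_k$, all $D_k$ and all $W_i$ are independent, with $D_k$ uniform on $[N]$ and $W_i$ uniform on $[2^F]$, one has $I\bigl((D_j)_{j\ne k};\,Z_k,X,D_k\bigr)=0$ for every $k$. The pair $(M,R)$ is achievable with demand privacy if for every $\varepsilon>0$ there are $F\ge1$ and an $(N,K,M,R)$-private scheme with file size $F$ and $\log_2|\mathcal J|\le\varepsilon F$ (the auxiliary transmission $J$ has negligible size).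 Let $R^{*p}_{N,K}(M)$ be the infimum of all $R\ge 0$ such that $(M,R)$ is achievable with demand privacy. **Theorem.** For all integers $N,K\ge1$ and all real $M\in[0,N]$, $R^*_{N,K}(M)$ is finite and $$R^{*p}_{N,K}(M)\le 8\,R^*_{N,K}(M).$$ In particular, for $0\le M<N$ one has $R^*_{N,K}(M)>0$ and $$\frac{R^{*p}_{N,K}(M)}{R^*_{N,K}(M)}\le 8 .$$ -/

import Mathlib

open MeasureTheory ProbabilityTheory
open scoped NNReal ENNReal

namespace CodedCaching

/-- The set `[2^{rF}] = {0, 1, …, 2^{rF} - 1}` of messages of `rF` bits; for a real exponent,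
the number of messages is `⌊2^{rF}⌋`. -/
abbrev Msg (r : ℝ) (F : ℕ) : Type := Fin ⌊(2 : ℝ) ^ (r * (F : ℝ))⌋₊

/-- The values of the library `W_0, …, W_{N-1}` of `N` files of `F` bits each. -/
abbrev Library (N F : ℕ) : Type := Fin N → Fin (2 ^ F)

/-- Demand vectors `(D_0, …, D_{K-1})` of `K` users for `N` files. -/
abbrev Demands (N K : ℕ) : Type := Fin K → Fin N

/-! ### Non-private schemes -/

/-- The maps `(C, E, G)` of a non-private coded caching scheme with file size `F`. -/
structure Scheme (N K : ℕ) (M R : ℝ) (F : ℕ) where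
  /-- cache encoding functions `C_k` -/
  cache : Fin K → Library N F → Msg M F
  /-- broadcast encoding function `E` -/
  enc : Library N F → Demands N K → Msg R F
  /-- decoding functions `G_k` -/
  dec : Fin K → Demands N K → Msg R F → Msg M F → Fin (2 ^ F)

/-- Every user recovers the requested file, for all demands and all files. -/
def Scheme.Decodable {N K : ℕ} {M R : ℝ} {F : ℕ} (c : Scheme N K M R F) : Prop :=
  ∀ (k : Fin K) (d : Demands N K) (w : Library N F),
    c.dec k d (c.enc w d) (c.cache k w) = w (d k)

/-- `(M, R)` is achievable for the `(N, K)` coded caching problem. -/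
def Achievable (N K : ℕ) (M R : ℝ) : Prop :=
  ∃ F : ℕ, 0 < F ∧ ∃ c : Scheme N K M R F, c.Decodable

/-- The memory-rate trade-off `R^*_{N,K}(M)`: the infimum of the rates `R` (necessarily
nonnegative) such that `(M, R)` is achievable, with `inf ∅ = ∞`. -/
noncomputable def optimalRate (N K : ℕ) (M : ℝ) : ℝ≥0∞ :=
  ⨅ (R : ℝ≥0) (_ : Achievable N K M R), (R : ℝ≥0∞)

/-! ### Demand-private schemes -/

/-- The mutual information `I(X; Y)` under `μ`: the relative entropy of the joint law
with respect to the product of the two marginal laws. -/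
noncomputable def mutualInfo {Ω α β : Type*} [MeasurableSpace Ω] [MeasurableSpace α]
    [MeasurableSpace β] (μ : Measure Ω) (X : Ω → α) (Y : Ω → β) : ℝ≥0∞ :=
  InformationTheory.klDiv (μ.map fun ω => (X ω, Y ω)) ((μ.map X).prod (μ.map Y))

/-- The data of a private coded caching scheme with file size `F`: the laws of the shared
randomness `S_k` (in a finite alphabet) and of the private randomness `P` of the server
(in any probability space), and the maps `(C, E, J, G)`, which are measurable in the value
of `P`. -/
structure PrivateScheme (N K : ℕ) (M R : ℝ) (F : ℕ) where
  /-- the size of the alphabet of `S_k` -/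
  keySize : Fin K → ℕ
  /-- the law of `S_k` -/
  keyLaw : ∀ k, ProbabilityMeasure (Fin (keySize k))
  /-- the set of values of `P` -/
  Priv : Type
  /-- its σ-algebra -/
  [privSpace : MeasurableSpace Priv]
  /-- the law of `P` -/
  privLaw : ProbabilityMeasure Priv
  /-- the size of the alphabet of the auxiliary transmission `J` -/
  auxSize : ℕ
  /-- cache encoding functions `C_k` -/
  cache : ∀ k, Fin (keySize k) → Priv → Library N F → Msg M F
  /-- broadcast encoding function `E` -/
  enc : Library N F → Demands N K → Priv → (∀ k, Fin (keySize k)) → Msg R F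
  /-- auxiliary transmission `J` -/
  aux : Demands N K → Priv → (∀ k, Fin (keySize k)) → Fin auxSize
  /-- decoding functions `G_k` -/
  dec : ∀ k, Fin N → Fin (keySize k) → Fin auxSize → Msg R F → Msg M F → Fin (2 ^ F)
  measurable_cache : ∀ k s w, Measurable fun p => cache k s p w
  measurable_enc : ∀ w d s, Measurable fun p => enc w d p s
  measurable_aux : ∀ d s, Measurable fun p => aux d p s

attribute [instance] PrivateScheme.privSpace

namespace PrivateScheme

variable {N K : ℕ} {M R : ℝ} {F : ℕ}

/-- The sample space: the values of `P`, `(S_k)`, `(D_k)` and `(W_i)`. -/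
abbrev Outcome (c : PrivateScheme N K M R F) : Type :=
  c.Priv × (∀ k, Fin (c.keySize k)) × Demands N K × Library N F

/-- The joint law of `P`, `(S_k)`, `(D_k)`, `(W_i)`: all of them are independent, each `D_k` is
uniform on the set of files and each `W_i` is uniform on `[2^F]`. -/
noncomputable def law (c : PrivateScheme N K M R F) : Measure c.Outcome :=
  (c.privLaw : Measure c.Priv).prod
    ((Measure.pi fun k => (c.keyLaw k : Measure (Fin (c.keySize k)))).prod
      ((Measure.pi fun _ : Fin K => uniformOn (Set.univ : Set (Fin N))).prod
        (Measure.pi fun _ : Fin N => uniformOn (Set.univ : Set (Fin (2 ^ F))))))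

/-- The broadcast message `X = (E(W, D, P, S), J(D, P, S))`. -/
def message (c : PrivateScheme N K M R F) : c.Outcome → Msg R F × Fin c.auxSize
  | (p, s, d, w) => (c.enc w d p s, c.aux d p s)

/-- The cache content `Z_k = (C_k(S_k, P, W), S_k)` of user `k`. -/
def cacheContent (c : PrivateScheme N K M R F) (k : Fin K) :
    c.Outcome → Msg M F × Fin (c.keySize k)
  | (p, s, _, w) => (c.cache k (s k) p w, s k)

/-- The demand `D_k` of user `k`. -/
def demand (c : PrivateScheme N K M R F) (k : Fin K) : c.Outcome → Fin N
  | (_, _, d, _) => d k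

/-- The demands of all users other than `k`. -/
def otherDemands (c : PrivateScheme N K M R F) (k : Fin K) :
    c.Outcome → ({j : Fin K // j ≠ k} → Fin N)
  | (_, _, d, _) => fun j => d j

/-- Every user recovers the requested file, for all values of the demands, the files and the
randomness. -/
def Decodable (c : PrivateScheme N K M R F) : Prop :=
  ∀ (k : Fin K) (p : c.Priv) (s : ∀ k, Fin (c.keySize k)) (d : Demands N K) (w : Library N F),
    c.dec k (d k) (s k) (c.aux d p s) (c.enc w d p s) (c.cache k (s k) p w) = w (d k)

/-- Demand privacy: for each user `k`, the mutual information between the demands of the other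
users and `(Z_k, X, D_k)` is zero. -/
def DemandPrivate (c : PrivateScheme N K M R F) : Prop :=
  ∀ k : Fin K,
    mutualInfo c.law (c.otherDemands k)
      (fun ω => (c.cacheContent k ω, c.message ω, c.demand k ω)) = 0

end PrivateScheme

/-- `(M, R)` is achievable with demand privacy for the `(N, K)` coded caching problem. That
`log₂ |𝒥|` is negligible compared to the file size `F` means that `log₂ |𝒥| / F` can be made
smaller than any `ε > 0`. -/
def PrivatelyAchievable (N K : ℕ) (M R : ℝ) : Prop :=
  ∀ ε : ℝ, 0 < ε → ∃ F : ℕ, 0 < F ∧ ∃ c : PrivateScheme N K M R F,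
    c.Decodable ∧ c.DemandPrivate ∧ Real.logb 2 (c.auxSize : ℝ) ≤ ε * (F : ℝ)

/-- The memory-rate trade-off with demand privacy `R^{*p}_{N,K}(M)`: the infimum of the rates
`R` (necessarily nonnegative) such that `(M, R)` is achievable with demand privacy, with
`inf ∅ = ∞`. -/
noncomputable def optimalPrivateRate (N K : ℕ) (M : ℝ) : ℝ≥0∞ :=
  ⨅ (R : ℝ≥0) (_ : PrivatelyAchievable N K M R), (R : ℝ≥0∞)

end CodedCaching

/-!
The comparison goes through two explicit private rates. Write `m = M / N` for the cached fraction
of the library and `n = min N K`. The private trade-off is at most both `n * (1 - m)` and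
`(1 - m) / m`, and the non-private one is at least an eighth of one of the two.

Upper bounds. It is enough to treat rational fractions `p / q ≤ m` (in
`optimalPrivateRate_le_of_rational`), with files whose parts are long bit strings, so that the
auxiliary transmission, of fixed size, becomes negligible.
* Rate `n * (1 - m)` (`privatelyAchievable_uncoded`): all users cache the same fraction of every
  file, and the remainders of `n` files, the demanded ones among them, are broadcast at randomly
  rotated positions. Each user learns the position of the demanded file only, as the positions are
  masked by one-time pads.
* Rate `(1 - m) / m` (`privatelyAchievable_multicast`): the Maddah-Ali–Niesen scheme for at least
  `N * K` virtual users `(k, s)`, where the virtual user `(k, s)` wants the file `s + (D_k - S_k)`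
  and user `k` plays `(k, S_k)`. The broadcast depends on the demands only through the differences
  `D_k - S_k`, which are one-time pads of the demands.

Privacy of either scheme is checked combinatorially (`UniformScheme.Concealing`): any change of the
other users' demands can be compensated by an injective change of keys, server randomness and files
that leaves the view of user `k` as it was. As all these are uniform, the joint law of demands and
view does not depend on the demands, and the mutual information vanishes
(`mutualInfo_eq_zero`).

Lower bound. The caches of `s` users and `q` broadcasts determine `s * q ≤ N` files, so counting
gives `s * q ≤ s * M + q * R` (`Achievable.cutset`). One user and `N` broadcasts suffice if `n ≤ 8`
or `m ≥ 1 / 8`; otherwise `s` is the least of `K`, `N / 2` and `1 / (2 * m)`, rounded down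
(`Achievable.lower_bound`).
-/

namespace CodedCaching

/-! ### Vanishing mutual information -/

/-- If the joint law of `(X, Y)` does not depend on its first coordinate, then `X` is uniform and
independent of `Y`, so `I(X; Y) = 0`. -/
theorem mutualInfo_eq_zero {Ω α β : Type*} [MeasurableSpace Ω] [Fintype α] [MeasurableSpace α]
    [MeasurableSingletonClass α] [Fintype β] [MeasurableSpace β] [MeasurableSingletonClass β]
    (μ : Measure Ω) [IsProbabilityMeasure μ] {X : Ω → α} {Y : Ω → β} (hX : Measurable X)
    (hY : Measurable Y)
    (h : ∀ a a' b, μ (X ⁻¹' {a} ∩ Y ⁻¹' {b}) ≤ μ (X ⁻¹' {a'} ∩ Y ⁻¹' {b})) :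
    mutualInfo μ X Y = 0 := by
  have hXY : Measurable fun ω => (X ω, Y ω) := hX.prodMk hY
  have := Measure.isProbabilityMeasure_map (μ := μ) hX.aemeasurable
  have := Measure.isProbabilityMeasure_map (μ := μ) hY.aemeasurable
  have := Measure.isProbabilityMeasure_map (μ := μ) hXY.aemeasurable
  have sumX (b : β) : ∑ a, μ (X ⁻¹' {a} ∩ Y ⁻¹' {b}) = μ (Y ⁻¹' {b}) := by
    have := sum_measure_preimage_singleton (μ := μ.restrict (Y ⁻¹' {b})) (f := X) Finset.univ
      fun a _ => hX (measurableSet_singleton a)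
    simpa [Measure.restrict_apply (hX (measurableSet_singleton _))] using this
  have sumY (a : α) : ∑ b, μ (X ⁻¹' {a} ∩ Y ⁻¹' {b}) = μ (X ⁻¹' {a}) := by
    have := sum_measure_preimage_singleton (μ := μ.restrict (X ⁻¹' {a})) (f := Y) Finset.univ
      fun b _ => hY (measurableSet_singleton b)
    simpa [Measure.restrict_apply (hY (measurableSet_singleton _)), Set.inter_comm] using this
  have heq (a a' b) : μ (X ⁻¹' {a} ∩ Y ⁻¹' {b}) = μ (X ⁻¹' {a'} ∩ Y ⁻¹' {b}) :=
    le_antisymm (h a a' b) (h a' a b)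
  have hcard (a : α) : Fintype.card α * μ (X ⁻¹' {a}) = 1 := by
    have hsum := sum_measure_preimage_singleton (μ := μ) (f := X) Finset.univ
      fun a _ => hX (measurableSet_singleton a)
    rw [Finset.sum_congr rfl (g := fun _ => μ (X ⁻¹' {a}))
      (fun a' _ => by rw [← sumY, ← sumY]; exact Finset.sum_congr rfl fun b _ => heq _ _ _)] at hsum
    simpa using hsum
  have hmap : (μ.map fun ω => (X ω, Y ω)) = (μ.map X).prod (μ.map Y) := by
    refine Measure.ext_of_singleton fun ⟨a, b⟩ => ?_
    have hpre : (fun ω => (X ω, Y ω)) ⁻¹' {(a, b)} = X ⁻¹' {a} ∩ Y ⁻¹' {b} := by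
      ext ω; simp
    rw [← Set.singleton_prod_singleton, Measure.prod_prod,
      Measure.map_apply hX (measurableSet_singleton a),
      Measure.map_apply hY (measurableSet_singleton b), Set.singleton_prod_singleton,
      Measure.map_apply hXY (measurableSet_singleton _), hpre, ← sumX b,
      Finset.sum_congr rfl fun a' _ => heq a' a b, Finset.sum_const, Finset.card_univ,
      nsmul_eq_mul, ← mul_assoc, mul_comm (μ _) (Fintype.card α : ℝ≥0∞), hcard, one_mul]
  rw [mutualInfo, hmap]
  exact InformationTheory.klDiv_self _

/-- On a finite space all of whose points have the same mass, an injection from `S` into `T`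
shows that `S` has at most the measure of `T`. -/
theorem measure_le_of_injOn {Ω : Type*} [MeasurableSpace Ω] [Finite Ω]
    [MeasurableSingletonClass Ω] {μ : Measure Ω} {c : ℝ≥0∞} (hc : ∀ ω, μ {ω} = c) {S T : Set Ω}
    (f : Ω → Ω) (hf : Set.MapsTo f S T) (hinj : Set.InjOn f S) : μ S ≤ μ T := by
  have : μ = c • Measure.count := Measure.ext_of_singleton fun ω => by simp [hc]
  rw [this, Measure.smul_apply, Measure.smul_apply, Measure.count_apply S.toFinite.measurableSet,
    Measure.count_apply T.toFinite.measurableSet, smul_eq_mul, smul_eq_mul]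
  exact mul_le_mul_right (ENat.toENNReal_le.2 (Set.encard_le_encard_of_injOn hf hinj)) _

/-! ### Schemes with uniform randomness -/

/-- The maps of a private scheme in which all randomness is uniform: the keys `S_k` on `Fin κ`, the
private randomness `P` of the server on `Fin ρ`. Files, cache contents, broadcasts and auxiliary
transmissions take their values in arbitrary types `A`, `C`, `X`, `J`; the caches do not use `P`. -/
structure UniformScheme (N K κ ρ : ℕ) (A C X J : Type) where
  /-- cache encoding functions -/
  cache : Fin K → Fin κ → (Fin N → A) → C
  /-- broadcast encoding function -/
  enc : (Fin N → A) → Demands N K → Fin ρ → (Fin K → Fin κ) → X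
  /-- auxiliary transmission -/
  aux : Demands N K → Fin ρ → (Fin K → Fin κ) → J
  /-- decoding functions -/
  dec : Fin K → Fin N → Fin κ → J → X → C → A

namespace UniformScheme

variable {N K κ ρ F : ℕ} {M R : ℝ} {A C X J : Type}

/-- Every user recovers the requested file. -/
def Decodable (u : UniformScheme N K κ ρ A C X J) : Prop :=
  ∀ k p s d w, u.dec k (d k) (s k) (u.aux d p s) (u.enc w d p s) (u.cache k (s k) w) = w (d k)

/-- A combinatorial form of demand privacy: if two demand vectors agree at user `k`, then some
injective change of the randomness and of the files turns the one into the other without user `k`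
noticing. -/
def Concealing (u : UniformScheme N K κ ρ A C X J) : Prop :=
  ∀ (k : Fin K) (d d' : Demands N K), d k = d' k →
    ∃ φ : Fin ρ × (Fin K → Fin κ) × (Fin N → A) → Fin ρ × (Fin K → Fin κ) × (Fin N → A),
      φ.Injective ∧ ∀ p s w, (φ (p, s, w)).2.1 k = s k ∧
        u.cache k (s k) (φ (p, s, w)).2.2 = u.cache k (s k) w ∧
        u.enc (φ (p, s, w)).2.2 d' (φ (p, s, w)).1 (φ (p, s, w)).2.1 = u.enc w d p s ∧
        u.aux d' (φ (p, s, w)).1 (φ (p, s, w)).2.1 = u.aux d p s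

variable [NeZero κ] [NeZero ρ] [Fintype J] [Nonempty C] [Nonempty X]

/-- The private scheme obtained by numbering the alphabets. -/
noncomputable def toPrivateScheme (u : UniformScheme N K κ ρ A C X J) (iA : Fin (2 ^ F) ≃ A)
    (iC : C ↪ Msg M F) (iX : X ↪ Msg R F) : PrivateScheme N K M R F where
  keySize _ := κ
  keyLaw _ := ⟨uniformOn Set.univ, inferInstance⟩
  Priv := Fin ρ
  privLaw := ⟨uniformOn Set.univ, inferInstance⟩
  auxSize := Fintype.card J
  cache k s _ w := iC (u.cache k s (iA ∘ w))
  enc w d p s := iX (u.enc (iA ∘ w) d p s)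
  aux d p s := Fintype.equivFin J (u.aux d p s)
  dec k i s j x z := iA.symm <|
    u.dec k i s ((Fintype.equivFin J).symm j) (Function.invFun iX x) (Function.invFun iC z)
  measurable_cache _ _ _ := measurable_from_top
  measurable_enc _ _ _ := measurable_from_top
  measurable_aux _ _ := measurable_from_top

theorem Decodable.toPrivateScheme {u : UniformScheme N K κ ρ A C X J} (hu : u.Decodable)
    (iA : Fin (2 ^ F) ≃ A) (iC : C ↪ Msg M F) (iX : X ↪ Msg R F) :
    (u.toPrivateScheme iA iC iX).Decodable := by
  intro k p s d w
  simp only [UniformScheme.toPrivateScheme, Equiv.symm_apply_apply,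
    Function.leftInverse_invFun iX.injective _, Function.leftInverse_invFun iC.injective _]
  rw [hu k p s d (iA ∘ w)]
  simp

/-- All outcomes have the same probability, so it is enough to compare numbers of outcomes; the
recoding maps outcomes with other demands `a` injectively to outcomes with other demands `a'` and
the same view of user `k`. -/
theorem Concealing.toPrivateScheme {u : UniformScheme N K κ ρ A C X J} (hu : u.Concealing)
    [NeZero N] (iA : Fin (2 ^ F) ≃ A) (iC : C ↪ Msg M F) (iX : X ↪ Msg R F) :
    (u.toPrivateScheme iA iC iX).DemandPrivate := by
  intro k
  set c := u.toPrivateScheme iA iC iX with hc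
  have : Finite c.Priv := inferInstanceAs (Finite (Fin ρ))
  have : MeasurableSingletonClass c.Priv := inferInstanceAs (MeasurableSingletonClass (Fin ρ))
  have hprob : IsProbabilityMeasure c.law := by
    unfold PrivateScheme.law; infer_instance
  obtain ⟨m, hm⟩ : ∃ m, ∀ ω, c.law {ω} = m := by
    refine ⟨(ρ : ℝ≥0∞)⁻¹ * ((∏ _ : Fin K, (κ : ℝ≥0∞)⁻¹) * ((∏ _ : Fin K, (N : ℝ≥0∞)⁻¹) *
      ∏ _ : Fin N, (((2 ^ F : ℕ) : ℝ≥0∞))⁻¹)), fun ⟨p, s, d, w⟩ => ?_⟩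
    have hunif (a : ℕ) (i : Fin a) : uniformOn (Set.univ : Set (Fin a)) {i} = (a : ℝ≥0∞)⁻¹ := by
      rw [uniformOn_univ, Measure.count_singleton, Fintype.card_fin, one_div]
    simp only [PrivateScheme.law, ← Set.singleton_prod_singleton, Measure.prod_prod,
      Measure.pi_singleton, hunif]
    congr 1
    · exact hunif ρ p
    · congr 1
      exact Finset.prod_congr rfl fun j _ => hunif κ (s j)
  refine mutualInfo_eq_zero c.law (.of_discrete) (.of_discrete) fun a a' b => ?_
  -- The demand vector with `d k` at `k` and `a` elsewhere.
  let D (a : {j : Fin K // j ≠ k} → Fin N) (i : Fin N) : Demands N K :=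
    fun j => if h : j ≠ k then a ⟨j, h⟩ else i
  have hD a i : D a i k = i := by simp [D]
  choose φ hφ using fun i => hu k (D a i) (D a' i) (by rw [hD, hD])
  let f : c.Outcome → c.Outcome := fun ω =>
    let v := φ (ω.2.2.1 k) (ω.1, ω.2.1, iA ∘ ω.2.2.2)
    (v.1, v.2.1, D a' (ω.2.2.1 k), iA.symm ∘ v.2.2)
  have hfib : ∀ p s d w, c.otherDemands k (p, s, d, w) = a → d = D a (d k) := by
    rintro p s d w rfl
    funext j
    by_cases h : j = k
    · subst h; simp [D]
    · simp [D, h, PrivateScheme.otherDemands]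
  refine measure_le_of_injOn hm f ?_ ?_
  · rintro ⟨p, s, d, w⟩ ⟨h1, h2⟩
    have hd := hfib p s d w h1
    obtain ⟨e1, e2, e3, e4⟩ := (hφ (d k)).2 p s (iA ∘ w)
    rw [← hd] at e3 e4
    have hA (v : Fin N → A) : iA ∘ iA.symm ∘ v = v := by ext; simp
    have hcache : c.cacheContent k (f (p, s, d, w)) = c.cacheContent k (p, s, d, w) := by
      change (iC (u.cache k ((φ (d k) (p, s, iA ∘ w)).2.1 k) (iA ∘ iA.symm ∘ _)), _) =
        (iC (u.cache k (s k) (iA ∘ w)), s k)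
      rw [e1, hA, e2]
    have hmsg : c.message (f (p, s, d, w)) = c.message (p, s, d, w) := by
      change (iX (u.enc (iA ∘ iA.symm ∘ _) _ _ _), Fintype.equivFin J _) =
        (iX (u.enc (iA ∘ w) d p s), Fintype.equivFin J (u.aux d p s))
      rw [hA, e3, e4]
    refine ⟨?_, ?_⟩
    · ext j
      simp [f, PrivateScheme.otherDemands, D, j.2]
    · rw [Set.mem_preimage, Set.mem_singleton_iff] at h2 ⊢
      rw [← h2, hcache, hmsg]
      exact congrArg (fun i => (_, _, i)) (hD a' (d k))
  · rintro ⟨p, s, d, w⟩ ⟨h1, -⟩ ⟨p', s', d', w'⟩ ⟨h1', -⟩ heq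
    have hd := hfib p s d w h1
    have hd' := hfib p' s' d' w' h1'
    have hk : d k = d' k := by
      have : D a' (d k) = D a' (d' k) := congrArg (fun ω => ω.2.2.1) heq
      simpa [hD] using congrFun this k
    have hfiles : iA.symm ∘ (φ (d k) (p, s, iA ∘ w)).2.2 =
        iA.symm ∘ (φ (d' k) (p', s', iA ∘ w')).2.2 := congrArg (fun ω => ω.2.2.2) heq
    have hφeq : φ (d k) (p, s, iA ∘ w) = φ (d' k) (p', s', iA ∘ w') :=
      Prod.ext (congrArg (fun ω => ω.1) heq) (Prod.ext (congrArg (fun ω => ω.2.1) heq)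
        (iA.symm.injective.comp_left hfiles))
    rw [← hk] at hφeq hd'
    have hpre := (hφ (d k)).1 hφeq
    have hp : p = p' := congrArg (fun v => v.1) hpre
    have hs : s = s' := congrArg (fun v => v.2.1) hpre
    have hw : iA ∘ w = iA ∘ w' := congrArg (fun v => v.2.2) hpre
    rw [hp, hs, hd.trans hd'.symm, iA.injective.comp_left hw]

end UniformScheme

/-- Room for `b` bits among the messages of rate `r`. -/
theorem two_pow_le_floor {b F : ℕ} {r : ℝ} (h : (b : ℝ) ≤ r * F) :
    2 ^ b ≤ ⌊(2 : ℝ) ^ (r * (F : ℝ))⌋₊ := by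
  refine Nat.le_floor ?_
  push_cast
  rw [← Real.rpow_natCast]
  exact Real.rpow_le_rpow_of_exponent_le one_le_two h

/-- A family of concealing schemes for arbitrarily long files with a fixed alphabet for the
auxiliary transmission achieves its rate with demand privacy. -/
theorem PrivatelyAchievable.of_uniformScheme {N K κ ρ f : ℕ} {M R : ℝ} [NeZero N] [NeZero κ]
    [NeZero ρ] (hf : 0 < f) {A C X : ℕ → Type} {J : Type} [Fintype J]
    [∀ L, Nonempty (C L)] [∀ L, Nonempty (X L)] (u : ∀ L, UniformScheme N K κ ρ (A L) (C L) (X L) J)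
    (hdec : ∀ L, (u L).Decodable) (hcon : ∀ L, (u L).Concealing) {b e : ℕ → ℕ}
    (hA : ∀ L, Nat.card (A L) = 2 ^ (f * L)) (hC : ∀ L, Nat.card (C L) = 2 ^ b L)
    (hX : ∀ L, Nat.card (X L) = 2 ^ e L) (hb : ∀ L, (b L : ℝ) ≤ M * (f * L : ℕ))
    (he : ∀ L, (e L : ℝ) ≤ R * (f * L : ℕ)) : PrivatelyAchievable N K M R := by
  intro ε hε
  obtain ⟨L, hL⟩ := exists_nat_gt (Real.logb 2 (Fintype.card J) / ε)
  rw [div_lt_iff₀ hε, mul_comm] at hL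
  have numbering {T : Type} {n : ℕ} (h : Nat.card T = 2 ^ n) : Nonempty (T ≃ Fin (2 ^ n)) :=
    have := Nat.finite_of_card_ne_zero (h ▸ pow_ne_zero n two_ne_zero)
    ⟨Finite.equivFinOfCardEq h⟩
  obtain ⟨iA⟩ := numbering (hA (L + 1))
  obtain ⟨iC⟩ := numbering (hC (L + 1))
  obtain ⟨iX⟩ := numbering (hX (L + 1))
  let jC : C (L + 1) ↪ Msg M (f * (L + 1)) :=
    iC.toEmbedding.trans (Fin.castLEEmb (two_pow_le_floor (hb _)))
  let jX : X (L + 1) ↪ Msg R (f * (L + 1)) :=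
    iX.toEmbedding.trans (Fin.castLEEmb (two_pow_le_floor (he _)))
  refine ⟨f * (L + 1), by positivity, (u (L + 1)).toPrivateScheme iA.symm jC jX,
    (hdec _).toPrivateScheme iA.symm jC jX, (hcon _).toPrivateScheme iA.symm jC jX, hL.le.trans ?_⟩
  gcongr
  nlinarith

/-! ### Private uncoded transmission -/

/-- The files can be listed so that the first `min N K` of them include all the demands. -/
theorem exists_listing {N K : ℕ} (d : Demands N K) :
    ∃ (e : Fin N ≃ Fin (min N K) ⊕ Fin (N - min N K)) (pos : Fin K → Fin (min N K)),
      ∀ k, e (d k) = Sum.inl (pos k) := by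
  obtain ⟨t, hdt, -, ht⟩ := Finset.exists_subsuperset_card_eq (n := min N K)
    (Finset.subset_univ (Finset.univ.image d))
    (le_min (by simpa using Finset.card_le_univ (Finset.univ.image d))
      (by simpa using Finset.card_image_le (s := Finset.univ) (f := d)))
    (by simp)
  have hd k : d k ∈ t := hdt (Finset.mem_image_of_mem d (Finset.mem_univ k))
  let e₁ : {i // i ∈ t} ≃ Fin (min N K) := Fintype.equivFinOfCardEq (by simpa using ht)
  let e₂ : {i // i ∉ t} ≃ Fin (N - min N K) :=
    Fintype.equivFinOfCardEq (by simp [Fintype.card_subtype_compl, ht])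
  refine ⟨(Equiv.sumCompl (· ∈ t)).symm.trans (e₁.sumCongr e₂), fun k => e₁ ⟨d k, hd k⟩,
    fun k => ?_⟩
  simp [Equiv.sumCompl_symm_apply_of_pos (p := (· ∈ t)) (hd k)]

/-- A listing of the files in which the demanded files have positions below `min N K`. -/
noncomputable def listing {N K : ℕ} (d : Demands N K) :
    Fin N ≃ Fin (min N K) ⊕ Fin (N - min N K) :=
  (exists_listing d).choose

/-- The position of the file demanded by user `k` in `listing d`. -/
noncomputable def listPos {N K : ℕ} (d : Demands N K) : Fin K → Fin (min N K) :=
  (exists_listing d).choose_spec.choose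

theorem listing_apply {N K : ℕ} (d : Demands N K) (k : Fin K) :
    listing d (d k) = Sum.inl (listPos d k) :=
  (exists_listing d).choose_spec.choose_spec k

/-- A file is a pair in `A₁ × A₂`. All users cache the first components of all files. The server
broadcasts the second components of `min N K` files that include the demanded ones, rotated by the
private randomness, and tells each user the position of the demanded file, masked by the user's
key. -/
noncomputable def uncodedScheme (N K : ℕ) [NeZero (min N K)] (A₁ A₂ : Type) :
    UniformScheme N K (min N K) (min N K) (A₁ × A₂) (Fin N → A₁) (Fin (min N K) → A₂)
      (Fin K → Fin (min N K)) where
  cache _ _ w i := (w i).1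
  enc w d c _ i := (w ((listing d).symm (Sum.inl (i - c)))).2
  aux d c s k := listPos d k + c - s k
  dec k i s j x z := (z i, x (j k + s))

theorem uncodedScheme_decodable (N K : ℕ) [NeZero (min N K)] (A₁ A₂ : Type) :
    (uncodedScheme N K A₁ A₂).Decodable := by
  intro k c s d w
  simp [uncodedScheme, ← listing_apply]

/-- The rotation is adjusted so that user `k` finds the file at the same position, the keys of the
other users so that the masked positions stay the same, and the second components of the files are
permuted so that the broadcast stays the same. -/
theorem uncodedScheme_concealing (N K : ℕ) [NeZero (min N K)] (A₁ A₂ : Type) :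
    (uncodedScheme N K A₁ A₂).Concealing := by
  intro k d d' _
  let δ := listPos d k - listPos d' k
  let τ : Equiv.Perm (Fin N) := (listing d').trans
    (((Equiv.addRight δ).sumCongr (Equiv.refl _)).trans (listing d).symm)
  refine ⟨fun v => (v.1 + δ, fun j => v.2.1 j + (listPos d' j + δ - listPos d j),
    fun i => ((v.2.2 i).1, (v.2.2 (τ i)).2)), ?_, fun c s w => ⟨?_, ?_, ?_, ?_⟩⟩
  · rintro ⟨c, s, w⟩ ⟨c', s', w'⟩ h
    simp only [Prod.mk.injEq, add_left_inj, funext_iff] at h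
    obtain ⟨hc, hs, hw⟩ := h
    refine Prod.ext hc (Prod.ext (funext hs) (funext fun i => Prod.ext (hw i).1 ?_))
    simpa using (hw (τ.symm i)).2
  · simp [δ]
  · simp [uncodedScheme]
  · funext i
    have : i - (c + δ) + δ = i - c := by abel
    simp [uncodedScheme, τ, this]
  · funext j
    simp only [uncodedScheme]
    abel

/-- Caching a fraction `p / q` of every file, the rate `min N K * (1 - p / q)` is achievable with
demand privacy. -/
theorem privatelyAchievable_uncoded {N K p q : ℕ} (hN : 1 ≤ N) (hK : 1 ≤ K) (hq : 0 < q)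
    (hpq : p ≤ q) {M R : ℝ} (hM : (p * N : ℝ) ≤ M * q)
    (hR : ((min N K : ℕ) * (q - p) : ℝ) ≤ R * q) : PrivatelyAchievable N K M R := by
  have : NeZero N := ⟨by lia⟩
  have : NeZero (min N K) := ⟨by lia⟩
  refine .of_uniformScheme hq
    (fun L => uncodedScheme N K (Fin (p * L) → Bool) (Fin ((q - p) * L) → Bool))
    (fun L => uncodedScheme_decodable N K _ _) (fun L => uncodedScheme_concealing N K _ _)
    (b := fun L => p * L * N) (e := fun L => (q - p) * L * min N K) ?_ ?_ ?_ ?_ ?_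
  · intro L
    simp only [Nat.card_eq_fintype_card, Fintype.card_prod, Fintype.card_fun, Fintype.card_bool,
      Fintype.card_fin]
    rw [← pow_add, ← add_mul, Nat.add_sub_cancel' hpq]
  · intro L; simp [pow_mul]
  · intro L; simp [pow_mul]
  · intro L
    push_cast
    nlinarith [mul_le_mul_of_nonneg_right hM L.cast_nonneg]
  · intro L
    push_cast [Nat.cast_sub hpq] at hR ⊢
    nlinarith [mul_le_mul_of_nonneg_right hR L.cast_nonneg]

/-! ### Private coded multicasting -/

/-- The subsets of size `t`, which index the parts of a file and the broadcast sums. -/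
abbrev Subsets (V : Type) [Fintype V] (t : ℕ) : Type := {T : Finset V // T.card = t}

/-- The number of parts of a file that a virtual user caches. -/
theorem card_subsets_mem {V : Type} [Fintype V] [DecidableEq V] (t : ℕ) (v : V) :
    Fintype.card {T : Subsets V t // v ∈ T.1} =
      (Fintype.card V).choose t - (Fintype.card V - 1).choose t := by
  have h : Fintype.card {T : Subsets V t // ¬ v ∈ T.1} = (Fintype.card V - 1).choose t := by
    rw [← Finset.card_univ (α := V), ← Finset.card_erase_of_mem (Finset.mem_univ v),
      ← Finset.card_powersetCard, ← Fintype.card_coe]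
    refine Fintype.card_congr ((Equiv.subtypeSubtypeEquivSubtypeInter
      (fun T : Finset V => T.card = t) (fun T => v ∉ T)).trans
      (Equiv.subtypeEquivRight fun T => ?_))
    rw [Finset.mem_powersetCard, Finset.subset_erase]
    simp [and_comm]
  have := Fintype.card_subtype_compl (fun T : Subsets V t => v ∈ T.1)
  have h2 := Fintype.card_subtype_le (fun T : Subsets V t => v ∈ T.1)
  rw [h, Fintype.card_finset_len] at this
  rw [Fintype.card_finset_len] at h2
  lia

section Subsets

variable {V : Type} [Fintype V] [DecidableEq V]

/-- The numbering of the parts of a file that the virtual user `v` caches. -/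
noncomputable def partEquiv (t : ℕ) (v : V) : {T : Subsets V t // v ∈ T.1} ≃
    Fin ((Fintype.card V).choose t - (Fintype.card V - 1).choose t) :=
  Fintype.equivFinOfCardEq (card_subsets_mem t v)

/-- The set `S` of size `t + 1` without its element `v`. -/
def Subsets.erase {t : ℕ} (S : Subsets V (t + 1)) (v : S.1) : Subsets V t :=
  ⟨S.1.erase v, by rw [Finset.card_erase_of_mem v.2, S.2]; rfl⟩

/-- The set `T` of size `t` together with a further element `v`. -/
def Subsets.insert {t : ℕ} (T : Subsets V t) {v : V} (h : v ∉ T.1) : Subsets V (t + 1) :=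
  ⟨Insert.insert v T.1, by rw [Finset.card_insert_of_notMem h, T.2]⟩

theorem Subsets.mem_erase_insert {t : ℕ} (T : Subsets V t) {v : V} (h : v ∉ T.1)
    {x : (T.insert h).1} (hx : x ≠ ⟨v, Finset.mem_insert_self v T.1⟩) :
    v ∈ ((T.insert h).erase x).1 :=
  Finset.mem_erase.2 ⟨fun h' => hx (Subtype.ext h'.symm), Finset.mem_insert_self v T.1⟩

theorem Subsets.erase_insert {t : ℕ} (T : Subsets V t) {v : V} (h : v ∉ T.1) :
    (T.insert h).erase ⟨v, Finset.mem_insert_self v T.1⟩ = T :=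
  Subtype.ext (Finset.erase_insert h)

end Subsets

/-- The demands of the virtual users when the masked demands `D_k - S_k` are `j`: the virtual user
`(k, s)` wants the file `j k + s`, which is `D_k` for the one that user `k` plays. The further
virtual users are needed only to adjust the cache size. -/
def virtualDemand {N K q : ℕ} (j : Fin K → Fin N) (v : Fin K × Fin N × Fin q) : Fin N :=
  j v.1 + v.2.1

/-- The Maddah-Ali–Niesen scheme for the virtual users `Fin K × Fin N × Fin q`. A file has one part
in `B` for each set of `t` virtual users, who cache it; for each set `S` of `t + 1` of them the
server broadcasts the sum over `v ∈ S` of the part for `S \ {v}` of the file that `v` wants. User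
`k` plays the virtual user `(k, S_k, 0)`, and the auxiliary transmission is `(D_k - S_k)_k`. -/
noncomputable def multicastScheme (N K q t : ℕ) [NeZero N] [NeZero q] (B : Type)
    [AddCommGroup B] :
    UniformScheme N K N 1 (Subsets (Fin K × Fin N × Fin q) t → B)
      (Fin N → Fin ((Fintype.card (Fin K × Fin N × Fin q)).choose t -
        (Fintype.card (Fin K × Fin N × Fin q) - 1).choose t) → B)
      (Subsets (Fin K × Fin N × Fin q) (t + 1) → B) (Fin K → Fin N) where
  cache k s w i a := w i ((partEquiv t (k, s, 0)).symm a)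
  enc w d _ s S := ∑ x : S.1, w (virtualDemand (fun k => d k - s k) x.1) (S.erase x)
  aux d _ s k := d k - s k
  dec k i s j y z T :=
    if h : (k, s, 0) ∈ T.1 then z i (partEquiv t (k, s, 0) ⟨T, h⟩)
    else y (T.insert h) - ∑ x : (T.insert h).1,
      if hx : x = ⟨(k, s, 0), Finset.mem_insert_self _ T.1⟩ then 0
      else z (virtualDemand j x.1)
        (partEquiv t (k, s, 0) ⟨(T.insert h).erase x, T.mem_erase_insert h hx⟩)

theorem multicastScheme_decodable (N K q t : ℕ) [NeZero N] [NeZero q] (B : Type)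
    [AddCommGroup B] : (multicastScheme N K q t B).Decodable := by
  intro k c s d w
  funext T
  simp only [multicastScheme, Equiv.symm_apply_apply]
  split_ifs with h
  · rfl
  · rw [← Finset.sum_sub_distrib, Finset.sum_eq_single
      (⟨(k, s k, 0), Finset.mem_insert_self _ T.1⟩ : (T.insert h).1)]
    · simp [Subsets.erase_insert, virtualDemand]
    · intro x _ hx
      simp [hx]
    · simp

/-- Cache contents, broadcast and auxiliary transmission depend on the demands only through
`D_k - S_k`, so shifting the keys along with the demands conceals the change. -/
theorem multicastScheme_concealing (N K q t : ℕ) [NeZero N] [NeZero q] (B : Type)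
    [AddCommGroup B] : (multicastScheme N K q t B).Concealing := by
  intro k d d' hk
  refine ⟨fun v => (v.1, fun j => v.2.1 j + (d' j - d j), v.2.2), ?_, fun c s w => ?_⟩
  · rintro ⟨c, s, w⟩ ⟨c', s', w'⟩ h
    simp only [Prod.mk.injEq, add_left_inj, funext_iff] at h
    exact Prod.ext h.1 (Prod.ext (funext h.2.1) (funext fun i => funext (h.2.2 i)))
  · have hshift (j : Fin K) : d' j - (s j + (d' j - d j)) = d j - s j := by abel
    simp [multicastScheme, hshift, hk]

/-- With `0 < p ≤ q` and cache size at least `N * p / q`, the rate `(1 - p / q) / (p / q)` is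
achievable with demand privacy. -/
theorem privatelyAchievable_multicast {N K p q : ℕ} (hN : 1 ≤ N) (hK : 1 ≤ K) (hp : 0 < p)
    (hpq : p ≤ q) {M R : ℝ} (hM : (p * N : ℝ) ≤ M * q) (hR : (q - p : ℝ) ≤ R * p) :
    PrivatelyAchievable N K M R := by
  have : NeZero N := ⟨by lia⟩
  have : NeZero q := ⟨by lia⟩
  set v := Fintype.card (Fin K × Fin N × Fin q) with hv
  have hvcard : v = K * N * q := by simp [hv, mul_assoc]
  obtain ⟨t, ht⟩ : ∃ t, t = K * N * p := ⟨_, rfl⟩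
  have hKN : 0 < K * N := by positivity
  have htv : t ≤ v := by rw [hvcard, ht]; exact Nat.mul_le_mul_left _ hpq
  have ht0 : 0 < t := by rw [ht]; positivity
  have hchoose : 0 < v.choose t := Nat.choose_pos htv
  have hle : (v - 1).choose t ≤ v.choose t := Nat.choose_le_choose t (Nat.sub_le v 1)
  have hvR : (v : ℝ) = K * N * q := by rw [hvcard]; push_cast; ring
  have htR : (t : ℝ) = K * N * p := by rw [ht]; push_cast; ring
  have hKNR : (0 : ℝ) < K * N := by exact_mod_cast hKN
  -- the cached fraction of a file is `t / v = p / q`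
  have hcache : ((v.choose t - (v - 1).choose t : ℕ) : ℝ) * q = v.choose t * p := by
    have h := Nat.choose_mul_succ_eq (v - 1) t
    rw [Nat.sub_add_cancel (ht0.trans_le htv)] at h
    have h' : ((v - 1).choose t : ℝ) * v = v.choose t * (v - t) := by
      rw [← Nat.cast_sub htv]; exact_mod_cast h
    rw [Nat.cast_sub hle]
    rw [hvR, htR] at h'
    refine mul_left_cancel₀ hKNR.ne' ?_
    linear_combination -h'
  -- the rate is `(v - t) / (t + 1) ≤ (q - p) / p`
  have hrate : ((v.choose (t + 1) : ℕ) : ℝ) * p ≤ v.choose t * (q - p) := by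
    have h := Nat.choose_succ_right_eq v t
    have h' : (v.choose (t + 1) : ℝ) * (t + 1) = v.choose t * (v - t) := by
      rw [← Nat.cast_sub htv]; exact_mod_cast h
    rw [hvR, htR] at h'
    refine le_of_mul_le_mul_left ?_ hKNR
    have : (0 : ℝ) ≤ v.choose (t + 1) := by positivity
    linarith
  have hp' : (0 : ℝ) < p := by exact_mod_cast hp
  have hq' : (0 : ℝ) < q := by exact_mod_cast hp.trans_le hpq
  have hchR : (0 : ℝ) ≤ v.choose t := by positivity
  refine .of_uniformScheme hchoose
    (fun L => multicastScheme N K q t (Fin L → ZMod 2))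
    (fun L => multicastScheme_decodable N K q t _) (fun L => multicastScheme_concealing N K q t _)
    (b := fun L => L * ((v.choose t - (v - 1).choose t) * N))
    (e := fun L => L * v.choose (t + 1)) ?_ ?_ ?_ ?_ ?_
  · intro L
    rw [Nat.card_fun, Nat.card_fun, Nat.card_zmod, Nat.card_fin, Nat.card_eq_fintype_card,
      Fintype.card_finset_len]
    rw [← pow_mul, mul_comm L]
  · intro L
    rw [Nat.card_fun, Nat.card_fun, Nat.card_fun, Nat.card_zmod, Nat.card_fin, Nat.card_fin,
      Nat.card_fin]
    rw [← pow_mul, ← pow_mul]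
  · intro L
    rw [Nat.card_fun, Nat.card_fun, Nat.card_zmod, Nat.card_fin, Nat.card_eq_fintype_card,
      Fintype.card_finset_len]
    rw [← pow_mul]
  · intro L
    push_cast
    refine le_of_mul_le_mul_right ?_ hq'
    calc (L * (((v.choose t - (v - 1).choose t : ℕ) : ℝ) * N)) * q
        = L * v.choose t * (p * N) := by linear_combination (L * N : ℝ) * hcache
      _ ≤ L * v.choose t * (M * q) := by gcongr
      _ = M * (v.choose t * L) * q := by ring
  · intro L
    push_cast
    refine le_of_mul_le_mul_right ?_ hp'
    calc (L * (v.choose (t + 1) : ℝ)) * p = L * (v.choose (t + 1) * p) := by ring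
      _ ≤ L * (v.choose t * (q - p)) := by gcongr
      _ ≤ L * (v.choose t * (R * p)) := by gcongr
      _ = R * (v.choose t * L) * p := by ring

/-! ### The cut-set bound -/

/-- The cut-set bound: `q` broadcasts together with the caches of `s` users determine `s * q` files,
so there must be enough values of the former for all values of the latter. -/
theorem Achievable.cutset {N K : ℕ} {M R : ℝ} (h : Achievable N K M R) {s q : ℕ}
    (hs1 : 1 ≤ s) (hsK : s ≤ K) (hsq : s * q ≤ N) : (s * q : ℝ) ≤ s * M + q * R := by
  obtain ⟨F, hF, c, hc⟩ := h
  obtain ⟨e⟩ : Nonempty (Fin q × Fin s ↪ Fin N) :=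
    Function.Embedding.nonempty_of_card_le (by simpa [mul_comm] using hsq)
  let lib (v : Fin q × Fin s → Fin (2 ^ F)) : Library N F :=
    Function.extend e v fun _ => ⟨0, by positivity⟩
  let dem (j : Fin q) : Demands N K := fun k => e (j, if h : k.1 < s then ⟨k, h⟩ else ⟨0, hs1⟩)
  let Φ (v : Fin q × Fin s → Fin (2 ^ F)) : (Fin s → Msg M F) × (Fin q → Msg R F) :=
    (fun i => c.cache (i.castLE hsK) (lib v), fun j => c.enc (lib v) (dem j))
  have hΦ : Φ.Injective := by
    intro v v' hv
    funext ⟨j, i⟩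
    have key (v : Fin q × Fin s → Fin (2 ^ F)) :
        c.dec (i.castLE hsK) (dem j) ((Φ v).2 j) ((Φ v).1 i) = v (j, i) := by
      refine (hc (i.castLE hsK) (dem j) (lib v)).trans ?_
      simp [dem, lib, e.injective.extend_apply]
    rw [← key v, ← key v', hv]
  have hcard := Fintype.card_le_of_injective Φ hΦ
  simp only [Fintype.card_fun, Fintype.card_prod, Fintype.card_fin] at hcard
  have hreal : (2 : ℝ) ^ ((F : ℝ) * (s * q)) ≤ 2 ^ ((F : ℝ) * (s * M + q * R)) := by
    calc (2 : ℝ) ^ ((F : ℝ) * (s * q)) = (((2 ^ F) ^ (q * s) : ℕ) : ℝ) := by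
          rw [← pow_mul]; push_cast; rw [← Real.rpow_natCast]; push_cast; ring_nf
      _ ≤ ((⌊(2 : ℝ) ^ (M * (F : ℝ))⌋₊ ^ s * ⌊(2 : ℝ) ^ (R * (F : ℝ))⌋₊ ^ q : ℕ) : ℝ) := by
          exact_mod_cast hcard
      _ ≤ ((2 : ℝ) ^ (M * (F : ℝ))) ^ s * ((2 : ℝ) ^ (R * (F : ℝ))) ^ q := by
          push_cast
          gcongr <;> exact Nat.floor_le (by positivity)
      _ = 2 ^ ((F : ℝ) * (s * M + q * R)) := by
          rw [← Real.rpow_mul_natCast zero_le_two, ← Real.rpow_mul_natCast zero_le_two,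
            ← Real.rpow_add two_pos]
          ring_nf
  rw [Real.rpow_le_rpow_left_iff one_lt_two] at hreal
  exact le_of_mul_le_mul_left hreal (by exact_mod_cast hF)

/-- With `q = ⌊N / s⌋` broadcasts, where `s ≤ N / 2`, rounding costs a factor less than `3 / 2`. -/
theorem Achievable.cutset_half {N K : ℕ} {m R : ℝ} (h : Achievable N K (m * N) R) (hm : 0 ≤ m)
    {s : ℕ} (hs1 : 1 ≤ s) (hsK : s ≤ K) (hsN : 2 * s ≤ N) : s - 3 / 2 * s ^ 2 * m ≤ R := by
  set q := N / s with hq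
  have hq2 : 2 ≤ q := (Nat.le_div_iff_mul_le hs1).2 hsN
  have hsq : s * q ≤ N := Nat.mul_div_le N s
  have hlt : N < s * (q + 1) := Nat.lt_mul_div_succ N hs1
  have hN : 2 * N ≤ 3 * (s * q) := by nlinarith
  have hcut := h.cutset hs1 hsK hsq
  have hN' : (2 * N : ℝ) ≤ 3 * (s * q) := by exact_mod_cast hN
  have hq0 : (0 : ℝ) < q := by exact_mod_cast (by lia : 0 < q)
  have hs0 : (0 : ℝ) < s := by exact_mod_cast hs1
  refine le_of_mul_le_mul_left ?_ hq0
  have : s * (m * N) ≤ s * (m * (3 / 2 * (s * q))) := by gcongr; linarith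
  nlinarith

theorem Achievable.one_sub_le {N K : ℕ} (hN : 1 ≤ N) (hK : 1 ≤ K) {m R : ℝ}
    (h : Achievable N K (m * N) R) : 1 - m ≤ R := by
  have hN0 : (0 : ℝ) < N := by exact_mod_cast hN
  have := h.cutset (s := 1) (q := N) le_rfl hK (by simp)
  push_cast at this
  refine le_of_mul_le_mul_left ?_ hN0
  linarith

/-- The cut-set bound, up to the factor `8`, in terms of the two private rates. -/
theorem Achievable.lower_bound {N K : ℕ} (hN : 1 ≤ N) (hK : 1 ≤ K) {m R : ℝ} (hm0 : 0 ≤ m)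
    (hm1 : m ≤ 1) (h : Achievable N K (m * N) R) :
    (min N K : ℕ) * (1 - m) ≤ 8 * R ∨ 0 < m ∧ (1 - m) / m ≤ 8 * R := by
  have hR := h.one_sub_le hN hK
  by_cases hm8 : 1 / 8 ≤ m
  · right
    have hm : 0 < m := by linarith
    refine ⟨hm, ?_⟩
    rw [div_le_iff₀ hm]
    nlinarith
  push Not at hm8
  by_cases hn : min N K ≤ 8
  · left
    have : ((min N K : ℕ) : ℝ) ≤ 8 := by exact_mod_cast hn
    nlinarith
  push Not at hn
  have hN9 : 9 ≤ N := by lia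
  have hminK : ((min N K : ℕ) : ℝ) ≤ K := by exact_mod_cast min_le_right N K
  have hminN : ((min N K : ℕ) : ℝ) ≤ N := by exact_mod_cast min_le_left N K
  have hmin0 : (0 : ℝ) ≤ ((min N K : ℕ) : ℝ) := by positivity
  by_cases ha : 2 * K ≤ N ∧ 2 * m * K ≤ 1
  · -- few users, small caches: all users
    left
    have := h.cutset_half hm0 hK le_rfl ha.1
    have hK0 : (0 : ℝ) ≤ K := by positivity
    nlinarith [ha.2, mul_le_mul_of_nonneg_left ha.2 hK0]
  by_cases hb : N < 2 * K ∧ m * N ≤ 1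
  · -- many users, less than one file per cache: half as many users as files, two broadcasts
    left
    have := h.cutset (s := N / 2) (q := 2) (by lia) (by lia) (Nat.div_mul_le_self N 2)
    have h3 : ((N / 2 : ℕ) : ℝ) * (m * N) ≤ (N / 2 : ℕ) * 1 := by gcongr; exact hb.2
    have h4 : (N : ℝ) ≤ 4 * (N / 2 : ℕ) := by exact_mod_cast (by lia : N ≤ 4 * (N / 2))
    push_cast at this
    nlinarith
  -- otherwise about `1 / (2 * m)` users
  right
  have hm : 0 < m := by
    rcases hm0.eq_or_lt with rfl | h0
    · simp at ha hb; lia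
    · exact h0
  have hs : ⌊1 / (2 * m)⌋₊ ≤ K ∧ 2 * ⌊1 / (2 * m)⌋₊ ≤ N := by
    have hfl : ((⌊1 / (2 * m)⌋₊ : ℕ) : ℝ) ≤ 1 / (2 * m) := Nat.floor_le (by positivity)
    by_cases h2 : 2 * K ≤ N
    · have h3 : 1 < 2 * m * K := by by_contra h'; exact ha ⟨h2, not_lt.1 h'⟩
      have : 1 / (2 * m) ≤ K := by rw [div_le_iff₀ (by positivity)]; linarith
      have : ⌊1 / (2 * m)⌋₊ ≤ K := by exact_mod_cast hfl.trans this
      lia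
    · have h3 : 1 < m * N := by by_contra h'; exact hb ⟨by lia, not_lt.1 h'⟩
      have h4 : 1 / (2 * m) ≤ N / 2 := by
        rw [div_le_div_iff₀ (by positivity) two_pos]; linarith
      have h5 : (2 : ℝ) * (⌊1 / (2 * m)⌋₊ : ℕ) ≤ N := by linarith
      have : 2 * ⌊1 / (2 * m)⌋₊ ≤ N := by exact_mod_cast h5
      lia
  set s := ⌊1 / (2 * m)⌋₊ with hsdef
  have hup : (s : ℝ) * m ≤ 1 / 2 := by
    have : (s : ℝ) ≤ 1 / (2 * m) := Nat.floor_le (by positivity)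
    calc (s : ℝ) * m ≤ 1 / (2 * m) * m := by gcongr
      _ = 1 / 2 := by field_simp
  have hlow : 3 / 8 ≤ (s : ℝ) * m := by
    have : 1 / (2 * m) < s + 1 := Nat.lt_floor_add_one _
    rw [div_lt_iff₀ (by positivity)] at this
    nlinarith
  have hs1 : 1 ≤ s := by
    rcases Nat.eq_zero_or_pos s with h0 | h0
    · rw [h0] at hlow; norm_num at hlow
    · exact h0
  have hcut := mul_le_mul_of_nonneg_right (h.cutset_half hm0 hs1 hs.1 hs.2) hm0
  refine ⟨hm, ?_⟩
  rw [div_le_iff₀ hm]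
  -- `y - 3/2 * y ^ 2 ≥ 1/8` for `3/8 ≤ y ≤ 1/2`, here with `y = s * m`
  nlinarith [mul_nonneg (sub_nonneg.2 hup) (sub_nonneg.2 hlow)]

/-! ### Comparison of the two trade-offs -/

theorem optimalRate_le {N K : ℕ} {M : ℝ} {R : ℝ≥0} (h : Achievable N K M R) :
    optimalRate N K M ≤ R :=
  iInf₂_le R h

theorem le_optimalRate {N K : ℕ} {M : ℝ} {x : ℝ≥0∞} (h : ∀ R : ℝ≥0, Achievable N K M R → x ≤ R) :
    x ≤ optimalRate N K M :=
  le_iInf₂ h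

/-- Without caching, the transmission of all files achieves the rate `N`. -/
theorem achievable_all {N K : ℕ} {M : ℝ} (hM : 0 ≤ M) : Achievable N K M N := by
  obtain ⟨i⟩ : Nonempty (Library N 1 ↪ Msg N 1) :=
    Function.Embedding.nonempty_of_card_le <| by
      simpa using two_pow_le_floor (b := N) (F := 1) (r := N) (by simp)
  have z : Msg M 1 := ⟨0, (two_pow_le_floor (b := 0) (F := 1) (r := M) (by simpa using hM))⟩
  have : Nonempty (Library N 1) := ⟨fun _ => 0⟩
  refine ⟨1, one_pos, ⟨fun _ _ => z, fun w _ => i w, fun k d x _ => Function.invFun i x (d k)⟩,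
    fun k d w => ?_⟩
  simp [Function.leftInverse_invFun i.injective w]

/-- To bound the private trade-off by a continuous function of `m`, it is enough to have private
schemes at the rational cache fractions `p / q ≤ m`. For `m > 0` these may be taken positive, which
allows functions with a pole, hence a meaningless value, at `0`. -/
theorem optimalPrivateRate_le_of_rational {N K : ℕ} {m : ℝ} (hm0 : 0 ≤ m) {g : ℝ → ℝ}
    (hg : ContinuousAt g m)
    (h : ∀ p q : ℕ, 0 < q → (p / q : ℝ) ≤ m → (0 < m → 0 < p) →
      optimalPrivateRate N K (m * N) ≤ ENNReal.ofReal (g (p / q))) :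
    optimalPrivateRate N K (m * N) ≤ ENNReal.ofReal (g m) := by
  have hlim : Filter.Tendsto (fun j : ℕ => ((⌊m * j⌋₊ : ℕ) : ℝ) / j) Filter.atTop (nhds m) :=
    (tendsto_nat_floor_mul_div_atTop hm0).comp tendsto_natCast_atTop_atTop
  refine ge_of_tendsto (ENNReal.tendsto_ofReal (hg.tendsto.comp hlim)) ?_
  have hpos : ∀ᶠ j : ℕ in Filter.atTop, 0 < m → 0 < ⌊m * j⌋₊ := by
    rcases hm0.eq_or_lt with rfl | hm
    · simp
    · filter_upwards [hlim.eventually (lt_mem_nhds hm)] with j hj _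
      refine Nat.pos_of_ne_zero fun h0 => ?_
      rw [h0] at hj
      simp at hj
  filter_upwards [Filter.eventually_gt_atTop 0, hpos] with j hj hjm
  have hj' : (0 : ℝ) < j := by exact_mod_cast hj
  exact h _ _ hj ((div_le_iff₀ hj').2 (Nat.floor_le (by positivity))) hjm

theorem optimalPrivateRate_le {N K : ℕ} {M R : ℝ} (hR : 0 ≤ R) (h : PrivatelyAchievable N K M R) :
    optimalPrivateRate N K M ≤ ENNReal.ofReal R :=
  iInf₂_le R.toNNReal (by rwa [Real.coe_toNNReal R hR])

theorem optimalPrivateRate_le_uncoded {N K : ℕ} (hN : 1 ≤ N) (hK : 1 ≤ K) {m : ℝ} (hm0 : 0 ≤ m)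
    (hm1 : m ≤ 1) :
    optimalPrivateRate N K (m * N) ≤ ENNReal.ofReal ((min N K : ℕ) * (1 - m)) := by
  refine optimalPrivateRate_le_of_rational (g := fun r => (min N K : ℕ) * (1 - r)) hm0
    (by fun_prop) fun p q hq hpq _ => ?_
  have hq' : (0 : ℝ) < q := by exact_mod_cast hq
  have hpq' : (p : ℝ) ≤ q := (div_le_one hq').1 (hpq.trans hm1)
  refine optimalPrivateRate_le (mul_nonneg (Nat.cast_nonneg _) (by linarith)) <|
    privatelyAchievable_uncoded hN hK hq (by exact_mod_cast hpq') ?_ (le_of_eq ?_)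
  · have := (div_le_iff₀ hq').1 hpq
    nlinarith [mul_le_mul_of_nonneg_right this N.cast_nonneg]
  · field_simp

theorem optimalPrivateRate_le_multicast {N K : ℕ} (hN : 1 ≤ N) (hK : 1 ≤ K) {m : ℝ} (hm0 : 0 < m)
    (hm1 : m ≤ 1) : optimalPrivateRate N K (m * N) ≤ ENNReal.ofReal ((1 - m) / m) := by
  refine optimalPrivateRate_le_of_rational (g := fun r => (1 - r) / r) hm0.le
    (by fun_prop (disch := exact hm0.ne')) fun p q hq hpq hp => ?_
  have hq' : (0 : ℝ) < q := by exact_mod_cast hq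
  have hp' : (0 : ℝ) < p := by exact_mod_cast hp hm0
  have hpq' : (p : ℝ) ≤ q := (div_le_one hq').1 (hpq.trans hm1)
  refine optimalPrivateRate_le
    (div_nonneg (sub_nonneg.2 ((div_le_one hq').2 hpq')) (by positivity)) <|
    privatelyAchievable_multicast hN hK (hp hm0) (by exact_mod_cast hpq') ?_ (le_of_eq ?_)
  · have := (div_le_iff₀ hq').1 hpq
    nlinarith [mul_le_mul_of_nonneg_right this N.cast_nonneg]
  · field_simp

end CodedCaching

theorem mainTheorem2 (N K : ℕ) (hN : 1 ≤ N) (hK : 1 ≤ K) (M : ℝ) (hM0 : 0 ≤ M) (hMN : M ≤ N) :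
    CodedCaching.optimalRate N K M ≠ ⊤ ∧
      CodedCaching.optimalPrivateRate N K M ≤ 8 * CodedCaching.optimalRate N K M ∧
      (M < N → 0 < CodedCaching.optimalRate N K M ∧
        CodedCaching.optimalPrivateRate N K M / CodedCaching.optimalRate N K M ≤ 8) := by
  have hN0 : (0 : ℝ) < N := by exact_mod_cast hN
  obtain ⟨m, rfl⟩ : ∃ m, M = m * N := ⟨M / N, by field_simp⟩
  have hm0 : 0 ≤ m := nonneg_of_mul_nonneg_left hM0 hN0
  have hm1 : m ≤ 1 := by nlinarith
  have hfin : CodedCaching.optimalRate N K (m * N) ≠ ⊤ :=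
    ne_top_of_le_ne_top ENNReal.coe_ne_top
      (CodedCaching.optimalRate_le (R := N) (by simpa using CodedCaching.achievable_all hM0))
  have hmain : CodedCaching.optimalPrivateRate N K (m * N) ≤
      8 * CodedCaching.optimalRate N K (m * N) := by
    rw [mul_comm (8 : ℝ≥0∞)]
    refine (ENNReal.div_le_iff_le_mul (b := 8) (by simp) (by simp)).1 ?_
    refine CodedCaching.le_optimalRate fun R hR => ?_
    rw [ENNReal.div_le_iff_le_mul (by simp) (by simp)]
    have h8 : (R : ℝ≥0∞) * 8 = ENNReal.ofReal (8 * R) := by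
      rw [ENNReal.ofReal_mul (by norm_num), ENNReal.ofReal_coe_nnreal, mul_comm]; simp
    rw [h8]
    rcases hR.lower_bound hN hK hm0 hm1 with h | ⟨hm, h⟩
    · exact (CodedCaching.optimalPrivateRate_le_uncoded hN hK hm0 hm1).trans
        (ENNReal.ofReal_le_ofReal h)
    · exact (CodedCaching.optimalPrivateRate_le_multicast hN hK hm hm1).trans
        (ENNReal.ofReal_le_ofReal h)
  refine ⟨hfin, hmain, fun hlt => ?_⟩
  have hm : m < 1 := by nlinarith
  have hpos : 0 < CodedCaching.optimalRate N K (m * N) := by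
    refine (ENNReal.ofReal_pos.2 (sub_pos.2 hm)).trans_le
      (CodedCaching.le_optimalRate fun R hR => ?_)
    rw [← ENNReal.ofReal_coe_nnreal]
    exact ENNReal.ofReal_le_ofReal (hR.one_sub_le hN hK)
  exact ⟨hpos, (ENNReal.div_le_iff hpos.ne' hfin).2 hmain⟩
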